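/- For a (possibly partial) Boolean function $F:X\to\{0,1\}$, $X\subseteq\{0,1\}^n$, let $F^{\oplus}(x,y)=F(x\oplus y)$ and $F^{\wedge}(x,y)=F(x\wedge y)$, with bitwise XOR and AND, be the two-party functions, each defined for those $(x,y)\in\{0,1\}^n\times\{0,1\}^n$ for which the right-hand side is defined. $F$ is total if $X=\{0,1\}^n$. A quantum query algorithm or two-party quantum communication protocol (two-way, without prior entanglement or shared randomness) whose probability of output $1$ on an input is $p$ computes a function nondeterministically if $p>0$ on the inputs of value $1$ and $p=0$ on the inputs of value $0$; exactly if $p=1$, respectively $p=0$; with unbounded error if $p>1/2$, respectively $p<1/2$. Nothing is required outside the domain of the function. Let $D:\mathbb{N}\to[0,\infty)$. (1) Assume that there is a procedure $\mathcal{A}$ that, for every $n$ and every function $F$ of $n$ bits, converts a nondeterministic (respectively, exact) quantum query algorithm for $F$ using $T(n)$ queries into a nondeterministic (respectively, exact) quantum communication protocol for $F^{\oplus}$ using $O(D(n)T(n))$ qubits of communication. Then $D(n)=\Omega(\log n)$. In the exact case $F$ ranges over all total and partial functions; in the nondeterministic case it suffices that $\mathcal{A}$ does this for all total functions. (2) Assume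 that there is a procedure $\mathcal{A}$ that, for every $n$ and every total function $F:\{0,1\}^n\to\{0,1\}$, converts an unbounded-error quantum query algorithm for $F$ using $T(n)$ queries into an unbounded-error quantum communication protocol for $F^{\wedge}$ using $O(D(n)T(n))$ qubits of communication. Then $D(n)=\Omega(\log n)$. Here the constant implied by $O(D(n)T(n))$ may depend on the sequence of functions and algorithms. -/

import Mathlib

open Filter Asymptotics

/-- An `n`-bit string. -/
abbrev BitString (n : ℕ) : Type := Fin n → Bool

/-- A (possibly partial) Boolean function of `n` bits; `F x = none` means that `x` is outside the
domain of `F`. -/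
abbrev PartialBoolFun (n : ℕ) : Type := BitString n → Option Bool

/-- `F` is total: its domain is all of `{0,1}^n`. -/
def PartialBoolFun.IsTotal {n : ℕ} (F : PartialBoolFun n) : Prop :=
  ∀ x, ∃ v, F x = some v

/-- The two-party function `(x, y) ↦ F (x ∘ y)`, where `∘` is a bitwise binary operation.
`F.distributed xor` is `F^⊕` and `F.distributed and` is `F^∧`. -/
def PartialBoolFun.distributed {n : ℕ} (F : PartialBoolFun n) (op : Bool → Bool → Bool) :
    BitString n → BitString n → Option Bool :=
  fun x y => F (fun i => op (x i) (y i))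

/-- The three requirements on the success probability. -/
inductive Setting where
  | nondeterministic
  | exact
  | unboundedError

/-- What a setting demands of the acceptance probability `p` (the probability of output `1`) on an
input where the function to be computed has the value `v`. -/
def Setting.Demands : Setting → Bool → ℝ → Prop
  | .nondeterministic, true, p => 0 < p
  | .nondeterministic, false, p => p = 0
  | .exact, true, p => p = 1
  | .exact, false, p => p = 0
  | .unboundedError, true, p => 1 / 2 < p
  | .unboundedError, false, p => p < 1 / 2

/-! ### Quantum query algorithms -/

/-- Basis states `|i, b, z⟩` of a query algorithm: an index `i` into the input (`none` is a null
index, whose query does nothing), a target bit `b`, and the content `z` of a workspace of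
dimension `w`. -/
abbrev QueryBasis (n w : ℕ) : Type := Option (Fin n) × Bool × Fin w

/-- The bit of `x` read at an index. The null index reads `0`. -/
def queriedBit {n : ℕ} (x : BitString n) : Option (Fin n) → Bool
  | none => false
  | some i => x i

/-- The oracle for `x`: the unitary `|i, b, z⟩ ↦ |i, b ⊕ x_i, z⟩` (an involution). -/
def queryOracle {n w : ℕ} (x : BitString n) (ψ : QueryBasis n w → ℂ) : QueryBasis n w → ℂ :=
  fun s => ψ (s.1, xor s.2.1 (queriedBit x s.1), s.2.2)

/-- A quantum query algorithm on `n`-bit inputs. It starts in the basis state `init`, applies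
`U 0`, a query, `U 1`, a query, ..., a query, `U queries`, and measures in the computational basis;
it outputs `1` iff the result lies in `accept`. (`U t` is not used for `t > queries`.) -/
structure QueryAlgorithm (n : ℕ) where
  queries : ℕ
  workDim : ℕ
  init : QueryBasis n workDim
  U : ℕ → Matrix.unitaryGroup (QueryBasis n workDim) ℂ
  accept : Finset (QueryBasis n workDim)

namespace QueryAlgorithm

variable {n : ℕ}

/-- The state after `t` queries and the unitary that follows them. -/
def state (A : QueryAlgorithm n) (x : BitString n) : ℕ → QueryBasis n A.workDim → ℂ
  | 0 => (A.U 0).1.mulVec (Pi.single A.init 1)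
  | t + 1 => (A.U (t + 1)).1.mulVec (queryOracle x (A.state x t))

/-- The probability that the algorithm outputs `1` on input `x`. -/
noncomputable def acceptProb (A : QueryAlgorithm n) (x : BitString n) : ℝ :=
  ∑ s ∈ A.accept, ‖A.state x A.queries s‖ ^ 2

/-- The algorithm computes `F` (on the domain of `F`) in the given setting. -/
def Computes (A : QueryAlgorithm n) (S : Setting) (F : PartialBoolFun n) : Prop :=
  ∀ x v, F x = some v → S.Demands v (A.acceptProb x)

end QueryAlgorithm

/-! ### Two-party quantum communication protocols -/

/-- A two-way quantum communication protocol without prior entanglement or shared randomness.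
The registers are Alice's private space (dimension `aliceDim`), a one-qubit channel, and Bob's
private space (dimension `bobDim`), initially in the product basis state
`|aliceInit⟩|0⟩|bobInit⟩`. The players alternate: the holder of the channel qubit applies a unitary,
depending on the own input, to the own private space and the channel, and then passes the channel
qubit to the other player. It is passed `qubits` times, so local unitaries are applied at the times
`0, ..., qubits`. After the last one the channel qubit is measured by its holder and the result is
the output. (The local unitaries at times `t > qubits` are not used.) -/
structure QuantumProtocol (n : ℕ) where
  qubits : ℕ
  aliceFirst : Bool
  aliceDim : ℕ
  bobDim : ℕ
  aliceInit : Fin aliceDim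
  bobInit : Fin bobDim
  alice : ℕ → BitString n → Matrix.unitaryGroup (Fin aliceDim × Bool) ℂ
  bob : ℕ → BitString n → Matrix.unitaryGroup (Bool × Fin bobDim) ℂ

namespace QuantumProtocol

variable {n : ℕ}

/-- Whether Alice holds the channel qubit at time `t`. -/
def aliceHolds (P : QuantumProtocol n) : ℕ → Bool
  | 0 => P.aliceFirst
  | t + 1 => !(P.aliceHolds t)

/-- The local operation at time `t`: the holder's unitary, tensored with the identity on the
private space of the other player. -/
def step (P : QuantumProtocol n) (x y : BitString n) (t : ℕ)
    (ψ : Fin P.aliceDim × Bool × Fin P.bobDim → ℂ) : Fin P.aliceDim × Bool × Fin P.bobDim → ℂ :=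
  fun s =>
    if P.aliceHolds t then
      ∑ r : Fin P.aliceDim × Bool, (P.alice t x).1 (s.1, s.2.1) r * ψ (r.1, r.2, s.2.2)
    else
      ∑ r : Bool × Fin P.bobDim, (P.bob t y).1 s.2 r * ψ (s.1, r)

/-- The state after the local operation at time `t`, that is, after `t` qubits of communication. -/
def state (P : QuantumProtocol n) (x y : BitString n) :
    ℕ → Fin P.aliceDim × Bool × Fin P.bobDim → ℂ
  | 0 => P.step x y 0 (Pi.single (P.aliceInit, false, P.bobInit) 1)
  | t + 1 => P.step x y (t + 1) (P.state x y t)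

/-- The probability that the output is `1` on the inputs `x` (Alice) and `y` (Bob). -/
noncomputable def acceptProb (P : QuantumProtocol n) (x y : BitString n) : ℝ :=
  ∑ i : Fin P.aliceDim, ∑ j : Fin P.bobDim, ‖P.state x y P.qubits (i, true, j)‖ ^ 2

/-- The protocol computes the (possibly partial) two-party function `G` in the given setting. -/
def Computes (P : QuantumProtocol n) (S : Setting)
    (G : BitString n → BitString n → Option Bool) : Prop :=
  ∀ x y v, G x y = some v → S.Demands v (P.acceptProb x y)

end QuantumProtocol

/-! ### Generic conversions of query algorithms into protocols -/

/-- A procedure that takes a function `F` and a query algorithm (for `F`) and returns a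
communication protocol. -/
abbrev ConversionProcedure : Type :=
  ∀ n : ℕ, PartialBoolFun n → QueryAlgorithm n → QuantumProtocol n

/-- In the setting `S`, the procedure `𝒜` converts every query algorithm for a function `F` of the
class `𝓕`, with `T(n)` queries, into a protocol for the distributed version of `F` with respect to
`op`, with `O(D(n) T(n))` qubits. (The implied constant may even depend on the sequences of
functions and of algorithms.) -/
def ConversionProcedure.Converts (𝒜 : ConversionProcedure) (S : Setting)
    (op : Bool → Bool → Bool) (𝓕 : ∀ n : ℕ, Set (PartialBoolFun n)) (D : ℕ → ℝ) : Prop :=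
  (∀ (n : ℕ) (F : PartialBoolFun n), F ∈ 𝓕 n → ∀ A : QueryAlgorithm n, A.Computes S F →
    (𝒜 n F A).Computes S (F.distributed op)) ∧
  (∀ (F : ∀ n : ℕ, PartialBoolFun n) (A : ∀ n : ℕ, QueryAlgorithm n),
    (∀ n, F n ∈ 𝓕 n) → (∀ n, (A n).Computes S (F n)) →
    (fun n : ℕ => ((𝒜 n (F n) (A n)).qubits : ℝ)) =O[atTop]
      (fun n : ℕ => D n * ((A n).queries : ℝ)))

/-! For each setting there are functions with one-query algorithms whose distributed versions need
about `(log n) / 2` qubits, so the overhead is all in `D`. Lower bounds: a protocol with `q` qubits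
has an acceptance matrix of rank at most `4 ^ (q + 1)` (`acceptProb_factor`). This bounds the size
of a nonsingular diagonal submatrix (`card_le_of_diagonal`) and of a set shattered around `1 / 2`
(`card_le_of_shatters`). Upper bounds: for XOR, Deutsch-Jozsa accepts the XOR of two Walsh codewords
with probability 1 if they are equal and 0 otherwise (`exists_equality_of_walsh`), which gives the
diagonal submatrix. For AND, OR has a one-query unbounded-error algorithm (`exists_or`), and unit
vectors on Alice's side are shattered by Bob's inputs. -/

/-! ### Rank bounds for communication protocols -/

namespace QuantumProtocol

variable {n : ℕ}

/-- One local operation doubles the number of product terms of a state at most. -/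
theorem step_factor (P : QuantumProtocol n) (t : ℕ) {ι : Type} [Fintype ι]
    (f : ι → BitString n → Fin P.aliceDim → Bool → ℂ)
    (g : ι → BitString n → Bool → Fin P.bobDim → ℂ)
    (ψ : BitString n → BitString n → Fin P.aliceDim × Bool × Fin P.bobDim → ℂ)
    (hψ : ∀ x y a c b, ψ x y (a, c, b) = ∑ h, f h x a c * g h y c b) :
    ∃ (f' : ι × Bool → BitString n → Fin P.aliceDim → Bool → ℂ)
      (g' : ι × Bool → BitString n → Bool → Fin P.bobDim → ℂ),
      ∀ x y a c b, P.step x y t (ψ x y) (a, c, b) = ∑ h, f' h x a c * g' h y c b := by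
  -- The new `Bool` is the channel value before the step; with it fixed, the sum over the holder's
  -- private space stays inside the holder's factor.
  by_cases hA : P.aliceHolds t = true
  · refine ⟨fun h x a c => ∑ a', (P.alice t x).1 (a, c) (a', h.2) * f h.1 x a' h.2,
      fun h y _ b => g h.1 y h.2 b, fun x y a c b => ?_⟩
    simp only [step, hA, if_true, hψ, Fintype.sum_prod_type, Finset.mul_sum, Finset.sum_mul]
    rw [Finset.sum_comm, Finset.sum_comm (s := (Finset.univ : Finset ι))]
    refine Finset.sum_congr rfl fun c' _ => ?_
    rw [Finset.sum_comm]
    exact Finset.sum_congr rfl fun h _ => Finset.sum_congr rfl fun a' _ => by ring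
  · refine ⟨fun h x a _ => f h.1 x a h.2,
      fun h y c b => ∑ b', (P.bob t y).1 (c, b) (h.2, b') * g h.1 y h.2 b', fun x y a c b => ?_⟩
    simp only [step, hA, hψ, Fintype.sum_prod_type, Finset.mul_sum]
    rw [Finset.sum_comm (s := (Finset.univ : Finset ι))]
    refine Finset.sum_congr rfl fun c' _ => ?_
    rw [Finset.sum_comm]
    exact Finset.sum_congr rfl fun h _ => Finset.sum_congr rfl fun b' _ => by ring

/-- After `t` qubits of communication the state has at most `2 ^ (t + 1)` product terms. -/
theorem state_factor (P : QuantumProtocol n) (t : ℕ) :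
    ∃ (ι : Type) (_ : Fintype ι), Fintype.card ι = 2 ^ (t + 1) ∧
      ∃ (f : ι → BitString n → Fin P.aliceDim → Bool → ℂ)
        (g : ι → BitString n → Bool → Fin P.bobDim → ℂ),
        ∀ x y a c b, P.state x y t (a, c, b) = ∑ h, f h x a c * g h y c b := by
  induction t with
  | zero =>
    -- The initial state is one product term; the local operation at time `0` already doubles it,
    -- hence the exponent `t + 1`.
    refine ⟨Unit × Bool, inferInstance, by simp, ?_⟩
    refine P.step_factor 0 (fun _ _ a c => if a = P.aliceInit ∧ c = false then 1 else 0)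
      (fun _ _ _ b => if b = P.bobInit then 1 else 0)
      (fun _ _ => Pi.single (P.aliceInit, false, P.bobInit) 1) fun x y a c b => ?_
    by_cases h1 : a = P.aliceInit <;> by_cases h2 : c = false <;>
      by_cases h3 : b = P.bobInit <;> simp [h1, h2, h3]
  | succ t ih =>
    obtain ⟨ι, hι, hcard, f, g, h⟩ := ih
    refine ⟨ι × Bool, inferInstance, by simp [hcard, pow_succ], ?_⟩
    exact P.step_factor (t + 1) f g (fun x y => P.state x y t) h

/-- The matrix of acceptance probabilities has rank at most `4 ^ (qubits + 1)`. -/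
theorem acceptProb_factor (P : QuantumProtocol n) :
    ∃ (ι : Type) (_ : Fintype ι), Fintype.card ι = 4 ^ (P.qubits + 1) ∧
      ∃ (f g : ι → BitString n → ℂ),
        ∀ x y, (P.acceptProb x y : ℂ) = ∑ h, f h x * g h y := by
  obtain ⟨ι, hι, hcard, f, g, h⟩ := P.state_factor P.qubits
  -- A squared modulus expands over pairs of terms; as the channel bit is fixed to `true`, the sums
  -- over the two private spaces separate.
  refine ⟨ι × ι, inferInstance, by
    rw [Fintype.card_prod, hcard, ← mul_pow]; norm_num,
    fun k x => ∑ a, f k.1 x a true * starRingEnd ℂ (f k.2 x a true),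
    fun k y => ∑ b, g k.1 y true b * starRingEnd ℂ (g k.2 y true b), fun x y => ?_⟩
  have key : ∀ a b, ((‖P.state x y P.qubits (a, true, b)‖ ^ 2 : ℝ) : ℂ) =
      ∑ k : ι × ι, (f k.1 x a true * starRingEnd ℂ (f k.2 x a true)) *
        (g k.1 y true b * starRingEnd ℂ (g k.2 y true b)) := by
    intro a b
    push_cast
    rw [← Complex.mul_conj', h, map_sum, Finset.sum_mul_sum, Fintype.sum_prod_type]
    refine Finset.sum_congr rfl fun i _ => Finset.sum_congr rfl fun j _ => ?_
    rw [map_mul]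
    ring
  simp only [acceptProb, Complex.ofReal_sum, key, Finset.sum_mul_sum]
  calc _ = ∑ a, ∑ k : ι × ι, ∑ b, (f k.1 x a true * starRingEnd ℂ (f k.2 x a true)) *
        (g k.1 y true b * starRingEnd ℂ (g k.2 y true b)) :=
        Finset.sum_congr rfl fun a _ => Finset.sum_comm
    _ = _ := Finset.sum_comm

/-- Among sufficiently many inputs of Alice there is a nontrivial affine dependence of the rows of
the matrix of acceptance probabilities. -/
theorem exists_affine_dependence (P : QuantumProtocol n) {κ : Type} [Fintype κ]
    (X : κ → BitString n) (hκ : 4 ^ (P.qubits + 2) < Fintype.card κ) :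
    ∃ c : κ → ℝ, c ≠ 0 ∧ ∑ i, c i = 0 ∧ ∀ y, ∑ i, c i * P.acceptProb (X i) y = 0 := by
  obtain ⟨ι, hι, hcard, f, g, h⟩ := P.acceptProb_factor
  -- Real coefficients are kept for later sign arguments, so the target has real dimension `2 * 4 ^
  -- (q + 1) + 1`, at most `4 ^ (q + 2)`.
  let L : (κ → ℝ) →ₗ[ℝ] (ι → ℂ) × ℝ :=
    (LinearMap.pi fun k => ∑ i, (LinearMap.proj i : (κ → ℝ) →ₗ[ℝ] ℝ).smulRight (f k (X i))).prod
      (∑ i, LinearMap.proj i)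
  have hdim : Module.finrank ℝ ((ι → ℂ) × ℝ) < Module.finrank ℝ (κ → ℝ) := by
    have h1 : Module.finrank ℝ (ι → ℂ) = Fintype.card ι * 2 := by
      rw [Module.finrank_pi_fintype]; simp
    rw [Module.finrank_prod, h1, Module.finrank_self, Module.finrank_fintype_fun_eq_card, hcard]
    have : 1 ≤ 4 ^ (P.qubits + 1) := Nat.one_le_pow _ _ (by norm_num)
    rw [pow_succ] at hκ
    omega
  obtain ⟨c, hc, hc0⟩ := (Submodule.ne_bot_iff _).1 (LinearMap.ker_ne_bot_of_finrank_lt hdim (f := L))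
  have hL : L c = 0 := hc
  refine ⟨c, hc0, by simpa [L] using congrArg Prod.snd hL, fun y => ?_⟩
  have hk : ∀ k, ∑ i, (c i : ℂ) * f k (X i) = 0 := fun k => by
    simpa [L] using congrFun (congrArg Prod.fst hL) k
  have : ((∑ i, c i * P.acceptProb (X i) y : ℝ) : ℂ) = 0 := by
    push_cast
    simp only [h, Finset.mul_sum]
    rw [Finset.sum_comm]
    refine Finset.sum_eq_zero fun k _ => ?_
    calc _ = (∑ i, (c i : ℂ) * f k (X i)) * g k y := by
          rw [Finset.sum_mul]; exact Finset.sum_congr rfl fun i _ => by ring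
      _ = 0 := by rw [hk, zero_mul]
  exact_mod_cast this

/-- A protocol whose acceptance probabilities form a nonsingular diagonal matrix on a family of
inputs needs logarithmic communication. -/
theorem card_le_of_diagonal (P : QuantumProtocol n) {κ : Type} [Fintype κ]
    (X : κ → BitString n) (hdiag : ∀ i, P.acceptProb (X i) (X i) ≠ 0)
    (hoff : ∀ i j, i ≠ j → P.acceptProb (X i) (X j) = 0) :
    Fintype.card κ ≤ 4 ^ (P.qubits + 2) := by
  by_contra! hκ
  obtain ⟨c, hc0, -, hc⟩ := P.exists_affine_dependence X hκ
  refine hc0 (funext fun j => ?_)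
  have := hc (X j)
  rw [Finset.sum_eq_single j (fun i _ hij => by rw [hoff i j hij, mul_zero]) (by simp)] at this
  exact (mul_eq_zero.1 this).resolve_right (hdiag j)

/-- A protocol whose acceptance probabilities realize all sign patterns around `1 / 2` on a family
of inputs of Alice needs logarithmic communication. -/
theorem card_le_of_shatters (P : QuantumProtocol n) {κ : Type} [Fintype κ]
    (X : κ → BitString n) (Y : (κ → Bool) → BitString n)
    (htrue : ∀ i s, s i = true → 1 / 2 < P.acceptProb (X i) (Y s))
    (hfalse : ∀ i s, s i = false → P.acceptProb (X i) (Y s) < 1 / 2) :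
    Fintype.card κ ≤ 4 ^ (P.qubits + 2) := by
  by_contra! hκ
  obtain ⟨c, hc0, hsum, hc⟩ := P.exists_affine_dependence X hκ
  obtain ⟨j, hj⟩ := Function.ne_iff.1 hc0
  -- With the sign pattern of `c`, all terms `c i * (p i - 1 / 2)` are nonnegative and the `j`-th is
  -- nonzero, yet they sum to zero.
  let s : κ → Bool := fun i => decide (0 < c i)
  have hnn : ∀ i, 0 ≤ c i * (P.acceptProb (X i) (Y s) - 1 / 2) := by
    intro i
    by_cases hi : 0 < c i
    · exact mul_nonneg hi.le (sub_nonneg.2 (htrue i s (by simp [s, hi])).le)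
    · exact mul_nonneg_of_nonpos_of_nonpos (not_lt.1 hi)
        (sub_nonpos.2 (hfalse i s (by simp [s, hi])).le)
  have hpos : c j * (P.acceptProb (X j) (Y s) - 1 / 2) ≠ 0 := by
    refine mul_ne_zero hj (sub_ne_zero.2 ?_)
    by_cases hi : 0 < c j
    · exact (htrue j s (by simp [s, hi])).ne'
    · exact (hfalse j s (by simp [s, hi])).ne
  have hzero : ∑ i, c i * (P.acceptProb (X i) (Y s) - 1 / 2) = 0 := by
    simp only [mul_sub, Finset.sum_sub_distrib, hc, ← Finset.sum_mul, hsum, zero_mul, sub_zero]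
  exact hpos ((Finset.sum_eq_zero_iff_of_nonneg fun i _ => hnn i).1 hzero j (Finset.mem_univ j))

end QuantumProtocol

/-! ### Algorithms with one query -/

/-- Every unit vector is a column of some unitary matrix. -/
theorem exists_unitary_mulVec_single {ι : Type} [Fintype ι] [DecidableEq ι] (i : ι) (u : ι → ℂ)
    (hu : ∑ s, ‖u s‖ ^ 2 = 1) :
    ∃ U : Matrix.unitaryGroup ι ℂ, ∀ s, U.1 s i = u s := by
  -- Only the value at `i` matters: on `{i}` orthonormality just says that `u` is a unit vector.
  let v : ι → EuclideanSpace ℂ ι := fun _ => WithLp.toLp 2 u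
  have hv : Orthonormal ℂ (({i} : Set ι).domRestrict v) := by
    refine ⟨fun j => ?_, fun j k hjk => (hjk (Subsingleton.elim j k)).elim⟩
    rw [EuclideanSpace.norm_eq, Real.sqrt_eq_one]
    exact hu
  obtain ⟨b, hb⟩ := hv.exists_orthonormalBasis_extension_of_card_eq (by simp)
  refine ⟨⟨(EuclideanSpace.basisFun ι ℂ).toBasis.toMatrix b,
    (EuclideanSpace.basisFun ι ℂ).toMatrix_orthonormalBasis_mem_unitary b⟩, fun s => ?_⟩
  have := hb i rfl
  simp [Module.Basis.toMatrix_apply, this, v]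

namespace QueryAlgorithm

variable {n : ℕ}

/-- The algorithm with one query that prepares a state by `U₀`, applies `U₁` after the query, and
measures. -/
def oneQuery (U₀ U₁ : Matrix.unitaryGroup (QueryBasis n 1) ℂ)
    (accept : Finset (QueryBasis n 1)) : QueryAlgorithm n where
  queries := 1
  workDim := 1
  init := (none, false, 0)
  U t := if t = 0 then U₀ else U₁
  accept := accept

/-- A state prepared by a query algorithm can be measured in the computational basis directly
after one query. -/
theorem exists_measure_after_query (u : QueryBasis n 1 → ℂ) (hu : ∑ s, ‖u s‖ ^ 2 = 1)
    (accept : Finset (QueryBasis n 1)) :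
    ∃ A : QueryAlgorithm n, A.queries = 1 ∧
      ∀ x, A.acceptProb x = ∑ s ∈ accept, ‖queryOracle x u s‖ ^ 2 := by
  obtain ⟨U, hU⟩ := exists_unitary_mulVec_single (none, false, 0) u hu
  refine ⟨oneQuery U 1 accept, rfl, fun x => ?_⟩
  have h0 : U.1.mulVec (Pi.single (none, false, 0) 1) = u := by
    ext s; simp [hU]
  simp [acceptProb, oneQuery, state, h0]

/-- The overlap of a state with its image under the oracle can be tested with one query. -/
theorem exists_overlap (u : QueryBasis n 1 → ℂ) (hu : ∑ s, ‖u s‖ ^ 2 = 1) :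
    ∃ A : QueryAlgorithm n, A.queries = 1 ∧
      ∀ x, A.acceptProb x = ‖∑ s, starRingEnd ℂ (u s) * queryOracle x u s‖ ^ 2 := by
  obtain ⟨U, hU⟩ := exists_unitary_mulVec_single (none, false, 0) u hu
  refine ⟨oneQuery U U⁻¹ {(none, false, 0)}, rfl, fun x => ?_⟩
  have h0 : U.1.mulVec (Pi.single (none, false, 0) 1) = u := by
    ext s; simp [hU]
  simp [acceptProb, oneQuery, state, h0, Matrix.mulVec, dotProduct, Matrix.star_apply, hU]

/-- The sign `(-1) ^ b`. -/
def boolSign (b : Bool) : ℝ := if b then -1 else 1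

/-- The Deutsch-Jozsa algorithm on a nonempty set of indices. -/
theorem exists_deutschJozsa (S : Finset (Option (Fin n))) (hS : S.Nonempty) :
    ∃ A : QueryAlgorithm n, A.queries = 1 ∧
      ∀ x, A.acceptProb x = ((∑ i ∈ S, boolSign (queriedBit x i)) / S.card) ^ 2 := by
  have hcard : (0 : ℝ) < S.card := by exact_mod_cast hS.card_pos
  set r : ℝ := (√(2 * S.card))⁻¹ with hr
  have hr2 : r * r = (2 * S.card : ℝ)⁻¹ := by
    rw [hr, ← mul_inv, Real.mul_self_sqrt (by positivity)]
  let u : QueryBasis n 1 → ℝ := fun s => if s.1 ∈ S then r * boolSign s.2.1 else 0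
  have hoverlap : ∀ x : BitString n, ∑ s : QueryBasis n 1,
      u s * u (s.1, xor s.2.1 (queriedBit x s.1), s.2.2) =
        (∑ i ∈ S, boolSign (queriedBit x i)) / S.card := by
    intro x
    rw [Finset.sum_div, Fintype.sum_prod_type, ← Finset.sum_filter_add_sum_filter_not _ (· ∈ S)]
    rw [Finset.sum_eq_zero (s := Finset.univ.filter (¬ · ∈ S)), add_zero]
    · refine Finset.sum_congr (by simp) fun i hi => ?_
      replace hi : i ∈ S := by simpa using hi
      have : boolSign (queriedBit x i) / S.card = 2 * (r * r) * boolSign (queriedBit x i) := by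
        rw [hr2]; field_simp
      rw [this]
      cases hb : queriedBit x i <;> simp [u, hi, hb, Fintype.sum_prod_type, boolSign] <;> ring
    · intro i hi
      replace hi : i ∉ S := by simpa using hi
      simp [u, hi]
  have hnorm : ∑ s, ‖((u s : ℝ) : ℂ)‖ ^ 2 = 1 := by
    have := hoverlap fun _ => false
    have hq : ∀ i, queriedBit (fun _ : Fin n => false) i = false := by rintro (_ | _) <;> rfl
    simp only [hq, boolSign, Bool.xor_false] at this
    simp only [Complex.norm_real, Real.norm_eq_abs, sq_abs]
    simp only [sq]
    rw [this]
    simp [hcard.ne']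
  obtain ⟨A, hA, hAx⟩ := exists_overlap (fun s => (u s : ℂ)) hnorm
  refine ⟨A, hA, fun x => ?_⟩
  rw [hAx, ← hoverlap]
  simp only [queryOracle, Complex.conj_ofReal, ← Complex.ofReal_mul, ← Complex.ofReal_sum,
    Complex.norm_real, Real.norm_eq_abs, sq_abs]

/-- An algorithm with one query whose acceptance probability crosses `1 / 2` when the input becomes
nonzero. -/
theorem exists_or (n : ℕ) :
    ∃ A : QueryAlgorithm n, A.queries = 1 ∧
      ∀ x, A.acceptProb x =
        1 / 2 + (2 * ((Finset.univ.filter fun i => x i = true).card : ℝ) - 1) / (4 * (n + 1)) := by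
  have hn : (0 : ℝ) < n + 1 := by positivity
  let w : QueryBasis n 1 → ℝ := fun s =>
    match s with
    | (none, true, _) => 1 / 2 - 1 / (4 * (n + 1))
    | (none, false, _) => 1 / 2 + 1 / (4 * (n + 1)) - n / (2 * (n + 1))
    | (some _, true, _) => 0
    | (some _, false, _) => 1 / (2 * (n + 1))
  have hw : ∀ s, 0 ≤ w s := by
    rintro ⟨_ | i, _ | _, z⟩
    · change (0 : ℝ) ≤ 1 / 2 + 1 / (4 * (n + 1)) - n / (2 * (n + 1))
      have : (1 : ℝ) / 2 + 1 / (4 * (n + 1)) - n / (2 * (n + 1)) = 3 / (4 * (n + 1)) := by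
        field_simp; ring
      rw [this]; positivity
    · change (0 : ℝ) ≤ 1 / 2 - 1 / (4 * (n + 1))
      have : (1 : ℝ) / 2 - 1 / (4 * (n + 1)) = (2 * n + 1) / (4 * (n + 1)) := by
        field_simp; ring
      rw [this]; positivity
    · change (0 : ℝ) ≤ 1 / (2 * (n + 1))
      positivity
    · exact le_rfl
  have hsq : ∀ s, ‖((√(w s) : ℝ) : ℂ)‖ ^ 2 = w s := fun s => by
    rw [Complex.norm_real, Real.norm_eq_abs, sq_abs, Real.sq_sqrt (hw s)]
  obtain ⟨A, hA, hAx⟩ := exists_measure_after_query (fun s => ((√(w s) : ℝ) : ℂ)) (by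
    simp only [hsq, Fintype.sum_prod_type, Fintype.sum_option]
    simp [w]
    field_simp
    ring) (Finset.univ.filter fun s => s.2.1 = true)
  refine ⟨A, hA, fun x => ?_⟩
  rw [hAx]
  simp only [queryOracle, hsq, Finset.sum_filter, Fintype.sum_prod_type, Fintype.sum_option]
  have hi : ∀ i : Fin n, w (some i, !x i, 0) = if x i = true then 1 / (2 * (n + 1) : ℝ) else 0 := by
    intro i; cases x i <;> rfl
  simp [queriedBit, hi, ← Finset.sum_filter]
  simp [w]
  field_simp
  ring

/-- The Walsh character of `a` at `c`, as a bit. -/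
def walsh {k : ℕ} (a c : Fin k → Bool) : Bool :=
  decide (Odd (Finset.univ.filter fun j => (a j && c j) = true).card)

theorem boolSign_walsh {k : ℕ} (a c : Fin k → Bool) :
    boolSign (walsh a c) = ∏ j, boolSign (a j && c j) := by
  simp only [boolSign, walsh, decide_eq_true_eq]
  rw [Finset.prod_ite, Finset.prod_const_one, mul_one, Finset.prod_const]
  split_ifs with h
  · rw [h.neg_one_pow]
  · rw [(Nat.not_odd_iff_even.1 h).neg_one_pow]

theorem boolSign_xor (a b : Bool) : boolSign (xor a b) = boolSign a * boolSign b := by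
  cases a <;> cases b <;> simp [boolSign]

theorem sum_boolSign_walsh {k : ℕ} (a b : Fin k → Bool) :
    ∑ c, boolSign (xor (walsh a c) (walsh b c)) = if a = b then 2 ^ k else 0 := by
  simp only [boolSign_xor, boolSign_walsh, ← Finset.prod_mul_distrib]
  rw [← Fintype.piFinset_univ,
    ← Finset.prod_univ_sum (fun _ => Finset.univ)
      (fun j d => boolSign (a j && d) * boolSign (b j && d))]
  split_ifs with h
  · subst h
    rw [Finset.prod_congr rfl (g := fun _ => (2 : ℝ)), Finset.prod_const, Finset.card_univ,
      Fintype.card_fin]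
    intro j _
    cases a j <;> norm_num [boolSign]
  · obtain ⟨j, hj⟩ := Function.ne_iff.1 h
    refine Finset.prod_eq_zero (Finset.mem_univ j) ?_
    cases ha : a j <;> cases hb : b j <;> simp_all [boolSign]

/-- With one query one can test the equality of Walsh codewords of length `2 ^ ⌊log₂ n⌋`, given
their bitwise XOR. -/
theorem exists_equality_of_walsh (n : ℕ) (hn : n ≠ 0) :
    ∃ A : QueryAlgorithm n, A.queries = 1 ∧
      ∃ X : (Fin (Nat.log 2 n) → Bool) → BitString n,
        ∀ a b, A.acceptProb (fun i => xor (X a i) (X b i)) = if a = b then 1 else 0 := by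
  obtain ⟨e⟩ : Nonempty ((Fin (Nat.log 2 n) → Bool) ↪ Fin n) :=
    Function.Embedding.nonempty_of_card_le (by simpa using Nat.pow_log_le_self 2 hn)
  obtain ⟨A, hA, hAx⟩ := exists_deutschJozsa
    (Finset.univ.map (e.trans Function.Embedding.some)) (by simp)
  refine ⟨A, hA, fun a i => Function.extend e (walsh a) (fun _ => false) i, fun a b => ?_⟩
  rw [hAx]
  simp only [Finset.sum_map, Function.Embedding.trans_apply, Function.Embedding.some_apply,
    queriedBit, e.injective.extend_apply, sum_boolSign_walsh]
  split_ifs <;> simp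

end QueryAlgorithm

/-! ### The lower bound -/

/-- If `n` is at most exponential in `q n` and `q = O(D)`, then `log n = O(D)`. -/
theorem isBigO_logb_of_le_pow {q : ℕ → ℕ} {D : ℕ → ℝ} (C : ℕ)
    (hq : ∀ᶠ n in atTop, n ≤ 4 ^ (q n + C)) (hD : (fun n => (q n : ℝ)) =O[atTop] D) :
    (fun n : ℕ => Real.logb 2 (n : ℝ)) =O[atTop] D := by
  refine IsBigO.trans (IsBigO.of_bound 4 ?_) hD
  have hlog : Tendsto (fun n : ℕ => Real.logb 2 (n : ℝ)) atTop atTop :=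
    (Real.tendsto_logb_atTop one_lt_two).comp tendsto_natCast_atTop_atTop
  filter_upwards [hq, hlog.eventually_ge_atTop (4 * C), eventually_ge_atTop 1] with n h h4 h1
  have hpos : (0 : ℝ) < n := by exact_mod_cast h1
  have hle : (n : ℝ) ≤ (2 : ℝ) ^ (((2 * (q n + C) : ℕ)) : ℝ) := by
    rw [Real.rpow_natCast, pow_mul]
    norm_num
    exact_mod_cast h
  have := (Real.logb_le_iff_le_rpow one_lt_two hpos).2 hle
  push_cast at this
  have hC : (0 : ℝ) ≤ C := Nat.cast_nonneg C
  rw [Real.norm_of_nonneg (by linarith), Real.norm_of_nonneg (Nat.cast_nonneg _)]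
  linarith

/-- Conversions have overhead `Ω(log n)` if for some functions with one-query algorithms all
protocols need logarithmic communication. -/
theorem ConversionProcedure.Converts.isBigO_logb {𝒜 : ConversionProcedure} {S : Setting}
    {op : Bool → Bool → Bool} {𝓕 : ∀ n : ℕ, Set (PartialBoolFun n)} {D : ℕ → ℝ}
    (h𝒜 : 𝒜.Converts S op 𝓕 D) (F : ∀ n, PartialBoolFun n) (A : ∀ n, QueryAlgorithm n)
    (hF : ∀ n, F n ∈ 𝓕 n) (hA : ∀ n, (A n).Computes S (F n)) (hq : ∀ n, (A n).queries = 1) (C : ℕ)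
    (hP : ∀ n, n ≠ 0 → ∀ P : QuantumProtocol n, P.Computes S ((F n).distributed op) →
      n ≤ 4 ^ (P.qubits + C)) :
    (fun n : ℕ => Real.logb 2 (n : ℝ)) =O[atTop] D := by
  refine isBigO_logb_of_le_pow (q := fun n => (𝒜 n (F n) (A n)).qubits) C ?_ ?_
  · filter_upwards [eventually_ne_atTop 0] with n hn
    exact hP n hn _ (h𝒜.1 n (F n) (hF n) (A n) (hA n))
  · simpa [hq] using h𝒜.2 F A hF hA

theorem le_pow_of_two_pow_log_le {n q : ℕ} (h : 2 ^ Nat.log 2 n ≤ 4 ^ (q + 2)) :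
    n ≤ 4 ^ (q + 3) := by
  have := Nat.lt_pow_succ_log_self one_lt_two n
  rw [pow_succ] at this ⊢
  omega

theorem QueryAlgorithm.exists_equality_of_walsh_family :
    ∃ A : ∀ n, QueryAlgorithm n, (∀ n, (A n).queries = 1) ∧
      ∀ n, n ≠ 0 → ∃ X : (Fin (Nat.log 2 n) → Bool) → BitString n,
        ∀ a b, (A n).acceptProb (fun i => xor (X a i) (X b i)) = if a = b then 1 else 0 := by
  have : ∀ n, ∃ A : QueryAlgorithm n, A.queries = 1 ∧
      (n ≠ 0 → ∃ X : (Fin (Nat.log 2 n) → Bool) → BitString n,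
        ∀ a b, A.acceptProb (fun i => xor (X a i) (X b i)) = if a = b then 1 else 0) := by
    intro n
    rcases eq_or_ne n 0 with rfl | hn
    · exact ⟨oneQuery 1 1 ∅, rfl, fun h => (h rfl).elim⟩
    · obtain ⟨A, hA, hX⟩ := exists_equality_of_walsh n hn
      exact ⟨A, hA, fun _ => hX⟩
  choose A hA hX using this
  exact ⟨A, hA, hX⟩

theorem theorem4 :
    -- (1), nondeterministic: it suffices that the procedure handles total functions
    (∀ (D : ℕ → ℝ) (𝒜 : ConversionProcedure), (∀ n, 0 ≤ D n) →
      𝒜.Converts Setting.nondeterministic xor (fun _ => {F | F.IsTotal}) D →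
      (fun n : ℕ => Real.logb 2 (n : ℝ)) =O[atTop] D) ∧
    -- (1), exact: the procedure handles total and partial functions
    (∀ (D : ℕ → ℝ) (𝒜 : ConversionProcedure), (∀ n, 0 ≤ D n) →
      𝒜.Converts Setting.exact xor (fun _ => Set.univ) D →
      (fun n : ℕ => Real.logb 2 (n : ℝ)) =O[atTop] D) ∧
    -- (2), unbounded error: it suffices that the procedure handles total functions
    (∀ (D : ℕ → ℝ) (𝒜 : ConversionProcedure), (∀ n, 0 ≤ D n) →
      𝒜.Converts Setting.unboundedError and (fun _ => {F | F.IsTotal}) D →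
      (fun n : ℕ => Real.logb 2 (n : ℝ)) =O[atTop] D) := by
  refine ⟨fun D 𝒜 _ h => ?_, fun D 𝒜 _ h => ?_, fun D 𝒜 _ h => ?_⟩
  · obtain ⟨A, hA, hX⟩ := QueryAlgorithm.exists_equality_of_walsh_family
    classical
    refine h.isBigO_logb (fun n x => some (decide ((A n).acceptProb x ≠ 0))) A
      (fun n x => ⟨_, rfl⟩) (fun n x v hv => ?_) hA 3 (fun n hn P hP => ?_)
    · obtain rfl := Option.some.inj hv
      have h0 : 0 ≤ (A n).acceptProb x := Finset.sum_nonneg fun _ _ => by positivity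
      by_cases hx : (A n).acceptProb x = 0
      · simp [hx, Setting.Demands]
      · simpa [hx, Setting.Demands] using lt_of_le_of_ne h0 (Ne.symm hx)
    · obtain ⟨X, hX⟩ := hX n hn
      refine le_pow_of_two_pow_log_le ?_
      have hcard := P.card_le_of_diagonal X
        (fun a => (hP (X a) (X a) true (by simp only [PartialBoolFun.distributed, hX]; simp)).ne')
        (fun a b hab => hP (X a) (X b) false (by simp [PartialBoolFun.distributed, hX, hab]))
      simpa using hcard
  · obtain ⟨A, hA, hX⟩ := QueryAlgorithm.exists_equality_of_walsh_family
    classical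
    refine h.isBigO_logb (fun n x => if (A n).acceptProb x = 1 then some true else
      if (A n).acceptProb x = 0 then some false else none) A
      (fun n => Set.mem_univ _) (fun n x v hv => ?_) hA 3 (fun n hn P hP => ?_)
    · dsimp only at hv
      split_ifs at hv with h1 h0
      · obtain rfl := Option.some.inj hv
        exact h1
      · obtain rfl := Option.some.inj hv
        exact h0
    · obtain ⟨X, hX⟩ := hX n hn
      refine le_pow_of_two_pow_log_le ?_
      have hdiag : ∀ a, P.acceptProb (X a) (X a) = 1 := fun a =>
        hP (X a) (X a) true (by simp only [PartialBoolFun.distributed, hX]; simp)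
      have hcard := P.card_le_of_diagonal X (fun a => by rw [hdiag]; exact one_ne_zero)
        (fun a b hab => hP (X a) (X b) false (by simp [PartialBoolFun.distributed, hX, hab]))
      simpa using hcard
  · choose A hA hAx using QueryAlgorithm.exists_or
    classical
    refine h.isBigO_logb (fun n x => some (decide (∃ i, x i = true))) A
      (fun n x => ⟨_, rfl⟩) (fun n x v hv => ?_) hA 2 (fun n hn P hP => ?_)
    · obtain rfl := Option.some.inj hv
      have hn : (0 : ℝ) < 4 * (n + 1) := by positivity
      by_cases hx : ∃ i, x i = true
      · have hc : (1 : ℝ) ≤ (Finset.univ.filter fun i => x i = true).card := by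
          obtain ⟨i, hi⟩ := hx
          exact_mod_cast Finset.card_pos.2 ⟨i, by simp [hi]⟩
        simp only [hx, decide_true, Setting.Demands, hAx]
        have := div_pos (by linarith : (0 : ℝ) <
          2 * ((Finset.univ.filter fun i => x i = true).card : ℝ) - 1) hn
        linarith
      · have hc : (Finset.univ.filter fun i => x i = true) = ∅ :=
          Finset.filter_eq_empty_iff.2 fun i _ hi => hx ⟨i, hi⟩
        simp only [hx, decide_false, Setting.Demands, hAx, hc]
        have := div_neg_of_neg_of_pos (by norm_num : (2 * ((∅ : Finset (Fin n)).card : ℝ) - 1) < 0) hn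
        linarith
    · have hcard := P.card_le_of_shatters (fun i j => decide (j = i)) id
        (fun i s hs => hP _ s true (by simp [PartialBoolFun.distributed, hs]))
        (fun i s hs => hP _ s false (by simp [PartialBoolFun.distributed, hs]))
      simpa using hcard
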